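/- Let $\mathbb C_+=\{z\in\mathbb C:\operatorname{Im} z>0\}$. An analytic function $f:\mathbb C_+\to\mathbb C$ is called \emph{inner} if it is bounded and $\lim_{y\searrow 0}|f(x+iy)|=1$ for almost every $x\in\mathbb R$. A \emph{meromorphic inner function} is an inner function that admits a meromorphic continuation to the whole complex plane; the continuation is denoted by the same letter and is analytic at every point of $\mathbb R$. There is an absolute constant $\varepsilon_0>0$ such that the following holds for every $0<\varepsilon<\varepsilon_0$. Let $\theta$ be a meromorphic inner function and let $x,y\in\mathbb R$ satisfy $\theta'(y)\neq 0$ and $$\frac{|\theta'(x)|}{|\theta'(y)|}>1+\varepsilon .$$ Then the disk $\{z\in\mathbb C: |z-x|<4|y-x|/\varepsilon\}$ contains a zero of $\theta$. -/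

import Mathlib

open Filter Topology MeasureTheory

/-- `f` is an inner function on the upper half-plane `{Im z > 0}`: it is analytic and bounded there,
and for almost every real `x` we have `lim_{y ↘ 0} |f (x + i y)| = 1`. Only the values of `f` on the
open upper half-plane matter. -/
structure IsInnerFunction (f : ℂ → ℂ) : Prop where
  analytic : AnalyticOnNhd ℂ f {z : ℂ | 0 < z.im}
  bounded : ∃ C : ℝ, ∀ z : ℂ, 0 < z.im → ‖f z‖ ≤ C
  unimodular : ∀ᵐ x : ℝ ∂volume,
    Tendsto (fun y : ℝ => ‖f ((x : ℂ) + (y : ℂ) * Complex.I)‖) (𝓝[>] 0) (𝓝 1)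

/-- `θ` is a meromorphic inner function: `θ` is a meromorphic function on the whole complex plane
whose restriction to the upper half-plane is inner. A meromorphic function is represented by its
normal form: removable singularities are filled in, so that `θ` is analytic at every point that is
not a pole, and the value at a pole is the dummy value `0`. -/
structure IsMeromorphicInner (θ : ℂ → ℂ) : Prop where
  meromorphic : MeromorphicNFOn θ Set.univ
  inner : IsInnerFunction θ

/-- `z` is a zero of the meromorphic function `θ`: `θ` is analytic at `z` (so `z` is not a pole) and
vanishes there. -/
def IsZeroOf (θ : ℂ → ℂ) (z : ℂ) : Prop :=
  AnalyticAt ℂ θ z ∧ θ z = 0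

/-!
On the real line an inner function satisfies `f' / f = i |f'|`, so `|f'|` is additive under
products. Dividing out the finitely many zeros in a large disk about `x` gives
`|f' x| = ∑ 2 Im λ / |x - λ| ^ 2 + |g' x|`, where `g` is inner without zeros in the disk. If all
zeros stay at distance at least `ρ` from `x`, then replacing `x` by `y` changes each term of the sum
by a factor of at most `(1 + |y - x| / ρ) ^ 2`. The function `-log |g|` extends by reflection to a
harmonic function on the disk, odd under conjugation and nonnegative on the upper half; the
antisymmetrized Poisson kernel then yields a boundary Harnack inequality `|g' x| ≤ C |g' y|` whose
constant tends to `1` with growing radius of the disk. Hence the factor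
`(1 + |y - x| / ρ) ^ 2` bounds the whole ratio, and it equals `1 + ε` for
`ρ = |y - x| / (√(1 + ε) - 1)`.
-/

open ComplexConjugate

section Comparison

theorem le_of_hasDerivAt_of_eventually_le_right {u v : ℝ → ℝ} {u' v' a : ℝ}
    (hu : HasDerivAt u u' a) (hv : HasDerivAt v v' a) (ha : u a = v a)
    (hle : ∀ᶠ t in 𝓝[>] a, u t ≤ v t) : u' ≤ v' := by
  refine le_of_tendsto_of_tendsto (hu.tendsto_slope.mono_left (nhdsGT_le_nhdsNE a))
    (hv.tendsto_slope.mono_left (nhdsGT_le_nhdsNE a)) ?_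
  filter_upwards [hle, self_mem_nhdsWithin] with t ht hat
  rw [slope_def_field, slope_def_field, ha]
  have : 0 < t - a := sub_pos.2 hat
  gcongr

theorem hasDerivAt_log_norm_add_ofReal_mul {f : ℂ → ℂ} {z : ℂ} (hf : DifferentiableAt ℂ f z)
    (hz : f z ≠ 0) (v : ℂ) :
    HasDerivAt (fun t : ℝ => Real.log ‖f (z + t * v)‖) (v * logDeriv f z).re 0 := by
  have hline : HasDerivAt (fun t : ℝ => z + t * v) v 0 := by
    simpa using ((Complex.ofRealCLM.hasDerivAt (x := (0 : ℝ))).mul_const v).const_add z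
  have hcomp : HasDerivAt (fun t : ℝ => f (z + t * v)) (deriv f z * v) 0 :=
    HasDerivAt.comp (h₂ := f) (0 : ℝ) (by simpa using hf.hasDerivAt) hline
  have hlog := (hcomp.norm_sq.log (by simpa using hz)).div_const 2
  simp only [Real.log_pow, Nat.cast_ofNat, mul_div_cancel_left₀ _ (two_ne_zero' ℝ)] at hlog
  refine hlog.congr_deriv ?_
  have hinv : v * logDeriv f z =
      deriv f z * v * conj (f z) * ((‖f z‖ ^ 2)⁻¹ : ℝ) := by
    rw [logDeriv_apply, div_eq_mul_inv, Complex.inv_def, Complex.normSq_eq_norm_sq]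
    ring
  rw [hinv, Complex.re_mul_ofReal]
  simp only [Complex.ofReal_zero, zero_mul, add_zero, Complex.inner]
  ring

end Comparison

section HalfPlane

theorem ofReal_re_of_im_eq_zero {z : ℂ} (hz : z.im = 0) : (z.re : ℂ) = z :=
  Complex.ext rfl hz.symm

theorem norm_conj_sub_ofReal (w : ℂ) (x : ℝ) : ‖conj w - x‖ = ‖w - x‖ := by
  rw [← Complex.norm_conj (w - x), map_sub, Complex.conj_ofReal]

theorem norm_ofReal_sub_conj (x : ℝ) (w : ℂ) : ‖(x : ℂ) - conj w‖ = ‖x - w‖ := by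
  rw [norm_sub_rev, norm_conj_sub_ofReal, norm_sub_rev]

theorem norm_sub_conj_sq_sub_norm_sub_sq (z w : ℂ) :
    ‖z - conj w‖ ^ 2 - ‖z - w‖ ^ 2 = 4 * w.im * z.im := by
  simp only [← Complex.normSq_eq_norm_sq, Complex.normSq_apply, Complex.sub_re, Complex.sub_im,
    Complex.conj_re, Complex.conj_im]
  ring

theorem sub_conj_ne_zero {l z : ℂ} (hl : 0 < l.im) (hz : 0 ≤ z.im) : z - conj l ≠ 0 := fun h => by
  have := congrArg Complex.im h
  simp only [Complex.sub_im, Complex.conj_im, Complex.zero_im] at this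
  linarith

theorem ofReal_sub_ne_zero {l : ℂ} (hl : 0 < l.im) (x : ℝ) : (x : ℂ) - l ≠ 0 := by
  rw [← norm_ne_zero_iff, ← norm_ofReal_sub_conj, norm_ne_zero_iff]
  exact sub_conj_ne_zero hl (Complex.ofReal_im x).ge

end HalfPlane

/-- An inner function on the upper half-plane that extends analytically across the real line. The
boundary condition then holds at every real point, and the Phragmén–Lindelöf principle gives the
bound by `1`. This class, unlike that of meromorphic inner functions, needs no choice of values
below the real line. -/
structure IsRegularInner (f : ℂ → ℂ) : Prop where
  analyticOnNhd : AnalyticOnNhd ℂ f {z : ℂ | 0 ≤ z.im}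
  norm_le_one : ∀ z : ℂ, 0 ≤ z.im → ‖f z‖ ≤ 1
  norm_ofReal : ∀ x : ℝ, ‖f x‖ = 1

namespace IsRegularInner

variable {f g : ℂ → ℂ}

theorem of_bounded (hf : AnalyticOnNhd ℂ f {z : ℂ | 0 ≤ z.im}) {C : ℝ}
    (hC : ∀ z : ℂ, 0 < z.im → ‖f z‖ ≤ C) (hreal : ∀ x : ℝ, ‖f x‖ = 1) : IsRegularInner f := by
  refine ⟨hf, fun z hz => ?_, hreal⟩
  have hdiff : DiffContOnCl ℂ (fun w => f (Complex.I * w)) {w | 0 < w.re} := by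
    refine DifferentiableOn.diffContOnCl fun w hw => ?_
    rw [Complex.closure_setOfPred_lt_re] at hw
    have hfw : DifferentiableAt ℂ f (Complex.I * w) :=
      (hf _ (by simpa using hw)).differentiableAt
    exact (hfw.comp w (by fun_prop)).differentiableWithinAt
  have hgrowth : (fun w => f (Complex.I * w))
      =O[Bornology.cobounded ℂ ⊓ 𝓟 {w | 0 < w.re}] fun w => Real.exp (0 * ‖w‖ ^ (1 : ℝ)) := by
    refine .of_bound C (eventually_inf_principal.2 (.of_forall fun w hw => ?_))
    simpa using hC (Complex.I * w) (by simpa using hw)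
  have hbdd : IsBoundedUnder (· ≤ ·) atTop fun t : ℝ => ‖f (Complex.I * t)‖ := by
    refine isBoundedUnder_of_eventually_le (a := C) ?_
    filter_upwards [eventually_gt_atTop 0] with t ht
    exact hC _ (by simpa using ht)
  have him (t : ℝ) : ‖f (Complex.I * (t * Complex.I))‖ ≤ 1 := by
    have hrot : Complex.I * (t * Complex.I) = ((-t : ℝ) : ℂ) := by
      rw [mul_left_comm, Complex.I_mul_I]
      simp
    rw [hrot, hreal]
  simpa [← mul_assoc] using PhragmenLindelof.right_half_plane_of_bounded_on_real
    (z := -Complex.I * z) hdiff ⟨1, one_lt_two, 0, hgrowth⟩ hbdd him (by simpa using hz)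

theorem ne_zero_ofReal (hf : IsRegularInner f) (x : ℝ) : f x ≠ 0 :=
  norm_ne_zero_iff.1 ((hf.norm_ofReal x).trans_ne one_ne_zero)

theorem analyticAt_ofReal (hf : IsRegularInner f) (x : ℝ) : AnalyticAt ℂ f x :=
  hf.analyticOnNhd x (Complex.ofReal_im x).ge

theorem norm_deriv_ofReal (hf : IsRegularInner f) (x : ℝ) : ‖deriv f x‖ = ‖logDeriv f x‖ := by
  rw [logDeriv_apply, norm_div, hf.norm_ofReal, div_one]

/- Along the real line `log ‖f‖` is constantly `0`, and upwards from it `log ‖f‖` is nonpositive: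
this fixes the argument of the logarithmic derivative. -/
theorem logDeriv_ofReal (hf : IsRegularInner f) (x : ℝ) :
    logDeriv f x = Complex.I * ‖deriv f x‖ := by
  have hderiv :=
    hasDerivAt_log_norm_add_ofReal_mul (hf.analyticAt_ofReal x).differentiableAt
      (hf.ne_zero_ofReal x)
  have hre : (logDeriv f x).re = 0 := by
    have hconst : (fun t : ℝ => Real.log ‖f (x + t * 1)‖) = fun _ => 0 := by
      ext t
      rw [mul_one, ← Complex.ofReal_add, hf.norm_ofReal, Real.log_one]
    have h := hderiv 1
    rw [hconst, one_mul] at h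
    exact h.unique (hasDerivAt_const _ _)
  have him : 0 ≤ (logDeriv f x).im := by
    have h := le_of_hasDerivAt_of_eventually_le_right (hderiv Complex.I)
      (hasDerivAt_const (0 : ℝ) (0 : ℝ)) (by simp [hf.norm_ofReal]) (by
        filter_upwards [self_mem_nhdsWithin] with t ht
        exact Real.log_nonpos (norm_nonneg _) (hf.norm_le_one _ (by simpa using ht.le)))
    simpa using h
  have himag : logDeriv f x = Complex.I * (logDeriv f x).im := by
    apply Complex.ext <;> simp [hre]
  rw [hf.norm_deriv_ofReal, himag]
  simp [abs_of_nonneg him]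

theorem hasDerivAt_log_norm (hf : IsRegularInner f) (x : ℝ) :
    HasDerivAt (fun t : ℝ => Real.log ‖f (x + t * Complex.I)‖) (-‖deriv f x‖) 0 := by
  refine (hasDerivAt_log_norm_add_ofReal_mul (hf.analyticAt_ofReal x).differentiableAt
    (hf.ne_zero_ofReal x) Complex.I).congr_deriv ?_
  rw [hf.logDeriv_ofReal, ← mul_assoc, Complex.I_mul_I, neg_one_mul, Complex.neg_re,
    Complex.ofReal_re]

theorem mul (hf : IsRegularInner f) (hg : IsRegularInner g) :
    IsRegularInner (fun z => f z * g z) where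
  analyticOnNhd := hf.analyticOnNhd.mul hg.analyticOnNhd
  norm_le_one z hz := by
    rw [norm_mul]
    exact mul_le_one₀ (hf.norm_le_one z hz) (norm_nonneg _) (hg.norm_le_one z hz)
  norm_ofReal x := by rw [norm_mul, hf.norm_ofReal, hg.norm_ofReal, one_mul]

theorem norm_deriv_mul (hf : IsRegularInner f) (hg : IsRegularInner g) (x : ℝ) :
    ‖deriv (fun z => f z * g z) x‖ = ‖deriv f x‖ + ‖deriv g x‖ := by
  rw [(hf.mul hg).norm_deriv_ofReal, logDeriv_mul _ (hf.ne_zero_ofReal x) (hg.ne_zero_ofReal x)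
    (hf.analyticAt_ofReal x).differentiableAt (hg.analyticAt_ofReal x).differentiableAt,
    hf.logDeriv_ofReal, hg.logDeriv_ofReal, ← mul_add, norm_mul, Complex.norm_I, one_mul,
    ← Complex.ofReal_add, Complex.norm_of_nonneg (by positivity)]

end IsRegularInner

section MeromorphicInner

variable {θ : ℂ → ℂ}

theorem tendsto_ofReal_add_mul_I (x : ℝ) :
    Tendsto (fun y : ℝ => (x : ℂ) + (y : ℂ) * Complex.I) (𝓝[>] 0) (𝓝[≠] (x : ℂ)) := by
  refine tendsto_nhdsWithin_iff.2 ⟨?_, ?_⟩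
  · exact (Continuous.tendsto' (by fun_prop) _ _ (by simp)).mono_left nhdsWithin_le_nhds
  · filter_upwards [self_mem_nhdsWithin] with t ht h
    exact (ne_of_gt ht) (by simpa using congrArg Complex.im h)

theorem IsMeromorphicInner.analyticAt_ofReal (hθ : IsMeromorphicInner θ) (x : ℝ) :
    AnalyticAt ℂ θ x := by
  have hnf : MeromorphicNFAt θ x := hθ.meromorphic (Set.mem_univ _)
  rw [← hnf.meromorphicOrderAt_nonneg_iff_analyticAt]
  by_contra! hpole
  obtain ⟨C, hC⟩ := hθ.inner.bounded
  have hblowup := (tendsto_norm_atTop_iff_cobounded.2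
    (tendsto_cobounded_of_meromorphicOrderAt_neg hpole)).comp (tendsto_ofReal_add_mul_I x)
  obtain ⟨t, hCt, ht⟩ := ((hblowup.eventually_gt_atTop C).and self_mem_nhdsWithin).exists
  exact (hC _ (by simpa using ht)).not_gt hCt

theorem IsMeromorphicInner.norm_ofReal (hθ : IsMeromorphicInner θ) (x : ℝ) : ‖θ x‖ = 1 := by
  have hcont : Continuous fun x : ℝ => ‖θ x‖ := continuous_iff_continuousAt.2 fun x =>
    ((hθ.analyticAt_ofReal x).continuousAt.comp (f := fun x : ℝ => (x : ℂ)) (by fun_prop)).norm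
  have hae : (fun x : ℝ => ‖θ x‖) =ᵐ[volume] fun _ => 1 := by
    filter_upwards [hθ.inner.unimodular] with x hx
    refine tendsto_nhds_unique ?_ hx
    exact ((hθ.analyticAt_ofReal x).continuousAt.tendsto.mono_left nhdsWithin_le_nhds).norm.comp
      (tendsto_ofReal_add_mul_I x)
  exact congrFun (Measure.eq_of_ae_eq hae hcont continuous_const) x

theorem IsMeromorphicInner.isRegularInner (hθ : IsMeromorphicInner θ) : IsRegularInner θ := by
  obtain ⟨C, hC⟩ := hθ.inner.bounded
  refine .of_bounded (fun z hz => ?_) hC hθ.norm_ofReal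
  rcases (show 0 ≤ z.im from hz).eq_or_lt with hreal | hupper
  · rw [← ofReal_re_of_im_eq_zero hreal.symm]
    exact hθ.analyticAt_ofReal _
  · exact hθ.inner.analytic z hupper

end MeromorphicInner

/-- The Blaschke factor of the upper half-plane with zero `l`, normalized to tend to `1` at
infinity. -/
noncomputable def blaschkeFactor (l z : ℂ) : ℂ :=
  (z - l) / (z - conj l)

section BlaschkeFactor

variable {l : ℂ}

theorem isRegularInner_blaschkeFactor (hl : 0 < l.im) : IsRegularInner (blaschkeFactor l) where
  analyticOnNhd z hz :=
    (analyticAt_id.sub analyticAt_const).div (analyticAt_id.sub analyticAt_const)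
      (sub_conj_ne_zero hl hz)
  norm_le_one z hz := by
    rw [blaschkeFactor, norm_div]
    refine div_le_one_of_le₀ (le_of_sq_le_sq ?_ (norm_nonneg _)) (norm_nonneg _)
    have := norm_sub_conj_sq_sub_norm_sub_sq z l
    have : 0 ≤ 4 * l.im * z.im := by positivity
    linarith
  norm_ofReal x := by
    rw [blaschkeFactor, norm_div, norm_ofReal_sub_conj,
      div_self (norm_ne_zero_iff.2 (ofReal_sub_ne_zero hl x))]

theorem norm_deriv_blaschkeFactor_ofReal (hl : 0 < l.im) (x : ℝ) :
    ‖deriv (blaschkeFactor l) x‖ = 2 * l.im / ‖x - l‖ ^ 2 := by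
  have hderiv : HasDerivAt (blaschkeFactor l)
      ((1 * (x - conj l) - (x - l) * 1) / (x - conj l) ^ 2) x :=
    ((hasDerivAt_id _).sub_const l).div ((hasDerivAt_id _).sub_const (conj l))
      (sub_conj_ne_zero hl (Complex.ofReal_im x).ge)
  rw [hderiv.deriv, one_mul, mul_one, sub_sub_sub_cancel_left, Complex.sub_conj, norm_div,
    norm_pow, norm_ofReal_sub_conj, norm_mul, Complex.norm_I, mul_one,
    Complex.norm_of_nonneg (by positivity)]

theorem norm_deriv_blaschkeFactor_le (hl : 0 < l.im) {x ρ : ℝ} (hρ : 0 < ρ) (hx : ρ ≤ ‖l - x‖)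
    (y : ℝ) :
    ‖deriv (blaschkeFactor l) x‖ ≤ (1 + |y - x| / ρ) ^ 2 * ‖deriv (blaschkeFactor l) y‖ := by
  rw [norm_sub_rev] at hx
  have hdist : ‖(y : ℂ) - l‖ ≤ (1 + |y - x| / ρ) * ‖(x : ℂ) - l‖ := calc
    ‖(y : ℂ) - l‖ ≤ |y - x| + ‖(x : ℂ) - l‖ := by
      have := norm_sub_le_norm_sub_add_norm_sub (y : ℂ) x l
      rwa [← Complex.ofReal_sub, Complex.norm_real, Real.norm_eq_abs] at this
    _ ≤ |y - x| / ρ * ‖(x : ℂ) - l‖ + ‖(x : ℂ) - l‖ := by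
      gcongr
      rw [div_mul_eq_mul_div, le_div_iff₀ hρ]
      gcongr
    _ = (1 + |y - x| / ρ) * ‖(x : ℂ) - l‖ := by ring
  have hxl := norm_pos_iff.2 (ofReal_sub_ne_zero hl x)
  have hyl := norm_pos_iff.2 (ofReal_sub_ne_zero hl y)
  rw [norm_deriv_blaschkeFactor_ofReal hl, norm_deriv_blaschkeFactor_ofReal hl, ← mul_div_assoc,
    div_le_div_iff₀ (by positivity) (by positivity)]
  calc 2 * l.im * ‖(y : ℂ) - l‖ ^ 2
      ≤ 2 * l.im * ((1 + |y - x| / ρ) * ‖(x : ℂ) - l‖) ^ 2 := by gcongr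
    _ = (1 + |y - x| / ρ) ^ 2 * (2 * l.im) * ‖(x : ℂ) - l‖ ^ 2 := by ring

end BlaschkeFactor

/-- The quotient of `f` by the Blaschke factor of its zero `l`; the difference quotient `dslope`
fills in the removable singularity at `l`. -/
noncomputable def blaschkeQuotient (f : ℂ → ℂ) (l z : ℂ) : ℂ :=
  (z - conj l) * dslope f l z

section BlaschkeQuotient

variable {f : ℂ → ℂ} {l : ℂ}

theorem sub_mul_blaschkeQuotient (hfl : f l = 0) (z : ℂ) :
    (z - l) * blaschkeQuotient f l z = (z - conj l) * f z := by
  rw [blaschkeQuotient, mul_left_comm, ← smul_eq_mul (z - l), sub_smul_dslope_of_zero hfl]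

theorem blaschkeFactor_mul_blaschkeQuotient (hfl : f l = 0) {z : ℂ} (hz : z - conj l ≠ 0) :
    blaschkeFactor l z * blaschkeQuotient f l z = f z := by
  rw [blaschkeFactor, div_mul_eq_mul_div, sub_mul_blaschkeQuotient hfl, mul_div_cancel_left₀ _ hz]

theorem analyticAt_blaschkeQuotient (hl : AnalyticAt ℂ f l) {z : ℂ} (hz : AnalyticAt ℂ f z) :
    AnalyticAt ℂ (blaschkeQuotient f l) z := by
  have hopen := isOpen_analyticAt ℂ f
  have hdslope : DifferentiableOn ℂ (dslope f l) {w | AnalyticAt ℂ f w} :=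
    (Complex.differentiableOn_dslope (hopen.mem_nhds hl)).2 fun w hw =>
      AnalyticAt.differentiableAt hw |>.differentiableWithinAt
  exact (analyticAt_id.sub analyticAt_const).mul (hdslope.analyticAt (hopen.mem_nhds hz))

variable (hf : IsRegularInner f) (hl : 0 < l.im) (hfl : f l = 0)
include hf hl hfl

theorem IsRegularInner.norm_blaschkeQuotient_le {z : ℂ} (hz : 0 ≤ z.im) (hzl : l.im ≤ ‖z - l‖) :
    ‖blaschkeQuotient f l z‖ ≤ 3 := by
  have hconj : ‖z - conj l‖ ≤ 3 * ‖z - l‖ := calc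
    ‖z - conj l‖ ≤ ‖z - l‖ + ‖l - conj l‖ := norm_sub_le_norm_sub_add_norm_sub z l _
    _ = ‖z - l‖ + 2 * l.im := by
      rw [Complex.sub_conj, norm_mul, Complex.norm_I, mul_one,
        Complex.norm_of_nonneg (by positivity)]
    _ ≤ 3 * ‖z - l‖ := by linarith
  refine le_of_mul_le_mul_left ?_ (hl.trans_le hzl)
  calc ‖z - l‖ * ‖blaschkeQuotient f l z‖ = ‖z - conj l‖ * ‖f z‖ := by
        rw [← norm_mul, sub_mul_blaschkeQuotient hfl, norm_mul]
    _ ≤ ‖z - conj l‖ := mul_le_of_le_one_right (norm_nonneg _) (hf.norm_le_one z hz)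
    _ ≤ ‖z - l‖ * 3 := by rwa [mul_comm]

theorem isRegularInner_blaschkeQuotient : IsRegularInner (blaschkeQuotient f l) := by
  have hanalytic : AnalyticOnNhd ℂ (blaschkeQuotient f l) {z | 0 ≤ z.im} := fun z hz =>
    analyticAt_blaschkeQuotient (hf.analyticOnNhd l hl.le) (hf.analyticOnNhd z hz)
  have hball : Metric.closedBall l l.im ⊆ {z : ℂ | 0 ≤ z.im} := fun z hz => by
    have := (abs_le.1 ((Complex.abs_im_le_norm (z - l)).trans (mem_closedBall_iff_norm.1 hz))).1
    rw [Complex.sub_im] at this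
    exact show 0 ≤ z.im by linarith
  obtain ⟨C, hC⟩ := (isCompact_closedBall l l.im).exists_bound_of_continuousOn
    (hanalytic.continuousOn.mono hball)
  refine .of_bounded hanalytic (C := max C 3) (fun z hz => ?_) fun x => ?_
  · rcases le_total ‖z - l‖ l.im with hnear | hfar
    · exact (hC z (mem_closedBall_iff_norm.2 hnear)).trans (le_max_left _ _)
    · exact (hf.norm_blaschkeQuotient_le hl hfl hz.le hfar).trans (le_max_right _ _)
  · have h := congrArg norm (blaschkeFactor_mul_blaschkeQuotient hfl
      (sub_conj_ne_zero hl (Complex.ofReal_im x).ge))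
    rwa [norm_mul, (isRegularInner_blaschkeFactor hl).norm_ofReal, one_mul, hf.norm_ofReal] at h

theorem IsRegularInner.norm_deriv_eq_add_blaschkeQuotient (x : ℝ) :
    ‖deriv f x‖ = ‖deriv (blaschkeFactor l) x‖ + ‖deriv (blaschkeQuotient f l) x‖ := by
  have hx : (x : ℂ) - conj l ≠ 0 := sub_conj_ne_zero hl (Complex.ofReal_im x).ge
  have hfactor : (fun z => blaschkeFactor l z * blaschkeQuotient f l z) =ᶠ[𝓝 (x : ℂ)] f := by
    have hnear : ∀ᶠ z in 𝓝 (x : ℂ), z - conj l ≠ 0 :=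
      ContinuousAt.eventually_ne (by fun_prop) hx
    filter_upwards [hnear] with z hz using blaschkeFactor_mul_blaschkeQuotient hfl hz
  rw [← hfactor.deriv_eq,
    (isRegularInner_blaschkeFactor hl).norm_deriv_mul (isRegularInner_blaschkeQuotient hf hl hfl)]

end BlaschkeQuotient

section FiniteFactorization

variable {f : ℂ → ℂ}

theorem IsRegularInner.exists_le_norm_deriv_blaschkeFactor (hf : IsRegularInner f) (x r : ℝ) :
    ∃ c > 0, ∀ l ∈ Metric.closedBall (x : ℂ) r, 0 < l.im → f l = 0 →
      c ≤ ‖deriv (blaschkeFactor l) x‖ := by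
  have hhalf : IsCompact (Metric.closedBall (x : ℂ) r ∩ {z | 0 ≤ z.im}) :=
    (isCompact_closedBall _ _).inter_right (isClosed_le continuous_const Complex.continuous_im)
  have hzeros : IsCompact (Metric.closedBall (x : ℂ) r ∩ {z | 0 ≤ z.im} ∩ f ⁻¹' {0}) :=
    hhalf.of_isClosed_subset ((hf.analyticOnNhd.continuousOn.mono
      Set.inter_subset_right).preimage_isClosed_of_isClosed hhalf.isClosed isClosed_singleton)
      Set.inter_subset_left
  have him : ∀ l ∈ Metric.closedBall (x : ℂ) r ∩ {z | 0 ≤ z.im} ∩ f ⁻¹' {0}, 0 < l.im := by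
    rintro l ⟨⟨-, hl⟩, hfl⟩
    refine lt_of_le_of_ne hl fun h => hf.ne_zero_ofReal l.re ?_
    rwa [ofReal_re_of_im_eq_zero h.symm]
  have hcont : ContinuousOn (fun l : ℂ => 2 * l.im / ‖(x : ℂ) - l‖ ^ 2)
      (Metric.closedBall (x : ℂ) r ∩ {z | 0 ≤ z.im} ∩ f ⁻¹' {0}) :=
    ContinuousOn.div (by fun_prop) (by fun_prop) fun l hl =>
      pow_ne_zero 2 (norm_ne_zero_iff.2 (ofReal_sub_ne_zero (him l hl) x))
  obtain ⟨c, hc, hcl⟩ := hzeros.exists_forall_le' hcont (a := 0) fun l hl => by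
    have := him l hl
    have := norm_pos_iff.2 (ofReal_sub_ne_zero (him l hl) x)
    positivity
  refine ⟨c, hc, fun l hl hl0 hfl => ?_⟩
  rw [norm_deriv_blaschkeFactor_ofReal hl0]
  exact hcl l ⟨⟨hl, hl0.le⟩, hfl⟩

/- Each division by a Blaschke factor lowers `‖f' x‖` by at least `c`, so that the zeros in the disk
are exhausted after finitely many steps. -/
theorem IsRegularInner.exists_norm_deriv_eq_sum_add_of_le (n : ℕ) {x r c : ℝ} (hc : 0 < c)
    (hf : IsRegularInner f) (hle : ‖deriv f x‖ ≤ n * c)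
    (hzero : ∀ l ∈ Metric.closedBall (x : ℂ) r, 0 < l.im → f l = 0 →
      c ≤ ‖deriv (blaschkeFactor l) x‖) :
    ∃ (L : Multiset ℂ) (g : ℂ → ℂ), (∀ l ∈ L, 0 < l.im ∧ f l = 0) ∧ IsRegularInner g ∧
      (∀ z ∈ Metric.closedBall (x : ℂ) r, 0 < z.im → g z ≠ 0) ∧
      ∀ s : ℝ, ‖deriv f s‖ = (L.map fun l => ‖deriv (blaschkeFactor l) s‖).sum + ‖deriv g s‖ := by
  induction n generalizing f with
  | zero =>
    refine ⟨0, f, by simp, hf, fun l hlr hl hfl => ?_, by simp⟩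
    have hstep := hzero l hlr hl hfl
    have hsplit := hf.norm_deriv_eq_add_blaschkeQuotient hl hfl x
    have := norm_nonneg (deriv (blaschkeQuotient f l) x)
    rw [Nat.cast_zero, zero_mul] at hle
    linarith
  | succ n ih =>
    by_cases! hex : ∀ l ∈ Metric.closedBall (x : ℂ) r, 0 < l.im → f l ≠ 0
    · exact ⟨0, f, by simp, hf, hex, by simp⟩
    obtain ⟨l, hlr, hl, hfl⟩ := hex
    have hstep := hzero l hlr hl hfl
    have hsplit := hf.norm_deriv_eq_add_blaschkeQuotient hl hfl
    have hinherit {z : ℂ} (hz : 0 < z.im) (hqz : blaschkeQuotient f l z = 0) : f z = 0 := by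
      rw [← blaschkeFactor_mul_blaschkeQuotient hfl (sub_conj_ne_zero hl hz.le), hqz, mul_zero]
    obtain ⟨L, g, hL, hg, hgfree, hsum⟩ := ih (isRegularInner_blaschkeQuotient hf hl hfl)
      (by have := hsplit x; push_cast at hle; linarith)
      fun z hzr hz hqz => hzero z hzr hz (hinherit hz hqz)
    refine ⟨l ::ₘ L, g, ?_, hg, hgfree, fun s => ?_⟩
    · exact Multiset.forall_mem_cons.2
        ⟨⟨hl, hfl⟩, fun z hz => ⟨(hL z hz).1, hinherit (hL z hz).1 (hL z hz).2⟩⟩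
    · rw [hsplit s, hsum s, Multiset.map_cons, Multiset.sum_cons, add_assoc]

theorem IsRegularInner.exists_norm_deriv_eq_sum_add (hf : IsRegularInner f) (x r : ℝ) :
    ∃ (L : Multiset ℂ) (g : ℂ → ℂ), (∀ l ∈ L, 0 < l.im ∧ f l = 0) ∧ IsRegularInner g ∧
      (∀ z ∈ Metric.closedBall (x : ℂ) r, 0 < z.im → g z ≠ 0) ∧
      ∀ s : ℝ, ‖deriv f s‖ = (L.map fun l => ‖deriv (blaschkeFactor l) s‖).sum + ‖deriv g s‖ := by
  obtain ⟨c, hc, hzero⟩ := hf.exists_le_norm_deriv_blaschkeFactor x r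
  obtain ⟨n, hn⟩ := exists_nat_ge (‖deriv f x‖ / c)
  exact hf.exists_norm_deriv_eq_sum_add_of_le n hc ((div_le_iff₀ hc).1 hn) hzero

end FiniteFactorization

theorem analyticAt_conj_comp_conj {f : ℂ → ℂ} {z : ℂ} (hf : AnalyticAt ℂ f (conj z)) :
    AnalyticAt ℂ (fun w => conj (f (conj w))) z := by
  rw [Complex.analyticAt_iff_eventually_differentiableAt]
  filter_upwards [Complex.continuous_conj.continuousAt.eventually hf.eventually_analyticAt]
    with w hw
  exact differentiableAt_conj_conj_iff.2 hw.differentiableAt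

theorem eventuallyEq_of_forall_ofReal_eq {f g : ℂ → ℂ} {x : ℝ} (hf : AnalyticAt ℂ f x)
    (hg : AnalyticAt ℂ g x) (h : ∀ t : ℝ, f t = g t) : f =ᶠ[𝓝 (x : ℂ)] g := by
  refine (hf.frequently_eq_iff_eventually_eq hg).1 ?_
  have hreal : Tendsto (fun t : ℝ => (t : ℂ)) (𝓝[≠] x) (𝓝[≠] (x : ℂ)) :=
    tendsto_nhdsWithin_iff.2 ⟨Complex.continuous_ofReal.continuousAt.mono_left nhdsWithin_le_nhds,
      eventually_mem_nhdsWithin.mono fun t ht => Complex.ofReal_injective.ne ht⟩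
  exact hreal.frequently (Frequently.of_forall h)

/-- The extension of a function on the closed upper half-plane across the real line by the
reflection `f (conj z) = 1 / conj (f z)`, for functions that are unimodular on the real line. -/
noncomputable def schwarzReflection (f : ℂ → ℂ) (z : ℂ) : ℂ :=
  if 0 ≤ z.im then f z else (conj (f (conj z)))⁻¹

section SchwarzReflection

variable {f : ℂ → ℂ}

theorem schwarzReflection_of_im_nonneg {z : ℂ} (hz : 0 ≤ z.im) : schwarzReflection f z = f z :=
  if_pos hz

theorem schwarzReflection_of_im_neg {z : ℂ} (hz : z.im < 0) :
    schwarzReflection f z = (conj (f (conj z)))⁻¹ :=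
  if_neg hz.not_ge

namespace IsRegularInner

theorem norm_schwarzReflection_conj (hf : IsRegularInner f) (z : ℂ) :
    ‖schwarzReflection f (conj z)‖ = ‖schwarzReflection f z‖⁻¹ := by
  rcases lt_trichotomy z.im 0 with hz | hz | hz
  · rw [schwarzReflection_of_im_neg hz, schwarzReflection_of_im_nonneg (by simpa using hz.le),
      norm_inv, inv_inv, Complex.norm_conj]
  · rw [← ofReal_re_of_im_eq_zero hz, Complex.conj_ofReal,
      schwarzReflection_of_im_nonneg (Complex.ofReal_im _).ge, hf.norm_ofReal, inv_one]
  · rw [schwarzReflection_of_im_nonneg hz.le, schwarzReflection_of_im_neg (by simpa using hz),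
      norm_inv, Complex.norm_conj, Complex.conj_conj]

theorem analyticAt_schwarzReflection_ofReal (hf : IsRegularInner f) (x : ℝ) :
    AnalyticAt ℂ (schwarzReflection f) x := by
  have hreflected : AnalyticAt ℂ (fun z => (conj (f (conj z)))⁻¹) x := by
    refine (analyticAt_conj_comp_conj ?_).inv ?_ <;> rw [Complex.conj_ofReal]
    · exact hf.analyticAt_ofReal x
    · exact (map_ne_zero _).2 (hf.ne_zero_ofReal x)
  have hagree : f =ᶠ[𝓝 (x : ℂ)] fun z => (conj (f (conj z)))⁻¹ :=
    eventuallyEq_of_forall_ofReal_eq (hf.analyticAt_ofReal x) hreflected fun t => by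
      rw [Complex.conj_ofReal, ← Complex.inv_eq_conj (hf.norm_ofReal t), inv_inv]
  refine (hf.analyticAt_ofReal x).congr ?_
  filter_upwards [hagree] with z hz
  rw [schwarzReflection, ← hz, ite_self]

theorem analyticAt_schwarzReflection (hf : IsRegularInner f) {z : ℂ}
    (hz : z.im < 0 → f (conj z) ≠ 0) : AnalyticAt ℂ (schwarzReflection f) z := by
  rcases lt_trichotomy z.im 0 with hlower | hreal | hupper
  · have hconj : 0 ≤ (conj z).im := by simpa using hlower.le
    refine ((analyticAt_conj_comp_conj (hf.analyticOnNhd _ hconj)).inv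
      ((map_ne_zero _).2 (hz hlower))).congr ?_
    filter_upwards [(isOpen_lt Complex.continuous_im continuous_const).mem_nhds hlower] with w hw
    exact (schwarzReflection_of_im_neg hw).symm
  · rw [← ofReal_re_of_im_eq_zero hreal]
    exact hf.analyticAt_schwarzReflection_ofReal _
  · refine (hf.analyticOnNhd z hupper.le).congr ?_
    filter_upwards [(isOpen_lt continuous_const Complex.continuous_im).mem_nhds hupper] with w hw
    exact (schwarzReflection_of_im_nonneg (le_of_lt hw)).symm

theorem schwarzReflection_ne_zero (hf : IsRegularInner f) {z : ℂ} (hupper : 0 < z.im → f z ≠ 0)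
    (hlower : z.im < 0 → f (conj z) ≠ 0) : schwarzReflection f z ≠ 0 := by
  rcases lt_trichotomy z.im 0 with hz | hz | hz
  · rw [schwarzReflection_of_im_neg hz]
    exact inv_ne_zero ((map_ne_zero _).2 (hlower hz))
  · rw [schwarzReflection_of_im_nonneg hz.ge, ← ofReal_re_of_im_eq_zero hz]
    exact hf.ne_zero_ofReal _
  · rw [schwarzReflection_of_im_nonneg hz.le]
    exact hupper hz

theorem harmonicOnNhd_neg_log_norm_schwarzReflection (hf : IsRegularInner f) {x r : ℝ}
    (hfree : ∀ z ∈ Metric.closedBall (x : ℂ) r, 0 < z.im → f z ≠ 0) :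
    InnerProductSpace.HarmonicOnNhd (fun z => -Real.log ‖schwarzReflection f z‖)
      (Metric.closedBall (x : ℂ) r) := fun z hz => by
  have hconj (hlower : z.im < 0) : f (conj z) ≠ 0 :=
    hfree _ (by rwa [mem_closedBall_iff_norm, norm_conj_sub_ofReal, ← mem_closedBall_iff_norm])
      (by simpa using hlower)
  exact ((hf.analyticAt_schwarzReflection hconj).harmonicAt_log_norm
    (hf.schwarzReflection_ne_zero (hfree z hz) hconj)).neg

end IsRegularInner

end SchwarzReflection

/-- The difference of the Poisson kernels of a disk centred at the real point `x` at a point `w` and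
at its conjugate, deprived of the factor `4 * w.im * z.im` that carries its sign. -/
noncomputable def reducedPoissonKernel (x : ℝ) (w z : ℂ) : ℝ :=
  (‖z - x‖ ^ 2 - ‖w - x‖ ^ 2) / (‖z - w‖ ^ 2 * ‖z - conj w‖ ^ 2)

section ReducedPoissonKernel

variable {x r q : ℝ} {w w' z : ℂ}

theorem poissonKernel_sub_poissonKernel_conj (hzw : z - w ≠ 0) (hzw' : z - conj w ≠ 0) :
    poissonKernel x w z - poissonKernel x (conj w) z =
      4 * w.im * z.im * reducedPoissonKernel x w z := by
  have := norm_ne_zero_iff.2 hzw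
  have := norm_ne_zero_iff.2 hzw'
  rw [poissonKernel_def, poissonKernel_def, sub_sub_sub_cancel_right, sub_sub_sub_cancel_right,
    norm_conj_sub_ofReal, reducedPoissonKernel, ← norm_sub_conj_sq_sub_norm_sub_sq]
  field_simp

theorem sub_ne_zero_of_mem_sphere_of_mem_ball {E : Type*} [SeminormedAddCommGroup E] {c z w : E}
    (hz : z ∈ Metric.sphere c r) (hw : w ∈ Metric.ball c r) : z - w ≠ 0 :=
  sub_ne_zero.2 fun h => (Metric.mem_ball.1 hw).ne (h ▸ Metric.mem_sphere.1 hz)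

theorem conj_mem_ball_ofReal (hw : w ∈ Metric.ball (x : ℂ) r) :
    conj w ∈ Metric.ball (x : ℂ) r := by
  rwa [mem_ball_iff_norm, norm_conj_sub_ofReal, ← mem_ball_iff_norm]

theorem continuousOn_reducedPoissonKernel (hw : w ∈ Metric.ball (x : ℂ) r) :
    ContinuousOn (reducedPoissonKernel x w) (Metric.sphere x r) :=
  ContinuousOn.div (by fun_prop) (by fun_prop) fun _ hz => mul_ne_zero
    (pow_ne_zero 2 (norm_ne_zero_iff.2 (sub_ne_zero_of_mem_sphere_of_mem_ball hz hw)))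
    (pow_ne_zero 2 (norm_ne_zero_iff.2
      (sub_ne_zero_of_mem_sphere_of_mem_ball hz (conj_mem_ball_ofReal hw))))

theorem norm_sub_mem_Icc_of_norm_sub_le {E : Type*} [SeminormedAddCommGroup E] {c z w : E}
    (hz : ‖z - c‖ = r) (hw : ‖w - c‖ ≤ q * r) :
    ‖z - w‖ ∈ Set.Icc ((1 - q) * r) ((1 + q) * r) := by
  have hlower := norm_sub_norm_le (z - c) (w - c)
  have hupper := norm_sub_le (z - c) (w - c)
  rw [sub_sub_sub_cancel_right] at hlower hupper
  constructor <;> linarith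

theorem reducedPoissonKernel_le (hr : 0 < r) (hq : q < 1) (hz : ‖z - x‖ = r)
    (hw : ‖w - x‖ ≤ q * r) : reducedPoissonKernel x w z ≤ 1 / ((1 - q) ^ 4 * r ^ 2) := by
  have : 0 < 1 - q := sub_pos.2 hq
  have hzw := (norm_sub_mem_Icc_of_norm_sub_le hz hw).1
  have hzw' := (norm_sub_mem_Icc_of_norm_sub_le hz ((norm_conj_sub_ofReal w x).trans_le hw)).1
  calc reducedPoissonKernel x w z
      ≤ r ^ 2 / (((1 - q) * r) ^ 2 * ((1 - q) * r) ^ 2) := by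
        rw [reducedPoissonKernel, hz]
        gcongr
        exact sub_le_self _ (sq_nonneg _)
    _ = 1 / ((1 - q) ^ 4 * r ^ 2) := by field_simp

theorem le_reducedPoissonKernel (hr : 0 < r) (hq : q < 1) (hz : ‖z - x‖ = r)
    (hw : ‖w - x‖ ≤ q * r) : (1 - q) / ((1 + q) ^ 3 * r ^ 2) ≤ reducedPoissonKernel x w z := by
  have : 0 < 1 - q := sub_pos.2 hq
  have hq0 : 0 ≤ q := nonneg_of_mul_nonneg_left ((norm_nonneg _).trans hw) hr
  obtain ⟨hlower, hupper⟩ := norm_sub_mem_Icc_of_norm_sub_le hz hw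
  obtain ⟨hlower', hupper'⟩ :=
    norm_sub_mem_Icc_of_norm_sub_le hz ((norm_conj_sub_ofReal w x).trans_le hw)
  have hzw : 0 < ‖z - w‖ := hlower.trans_lt' (by positivity)
  have hzw' : 0 < ‖z - conj w‖ := hlower'.trans_lt' (by positivity)
  calc (1 - q) / ((1 + q) ^ 3 * r ^ 2)
      = (r ^ 2 - (q * r) ^ 2) / (((1 + q) * r) ^ 2 * ((1 + q) * r) ^ 2) := by
        field_simp
        ring
    _ ≤ reducedPoissonKernel x w z := by
        rw [reducedPoissonKernel, hz]
        have : 0 ≤ r ^ 2 - ‖w - x‖ ^ 2 :=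
          sub_nonneg.2 (by gcongr; exact hw.trans (mul_le_of_le_one_left hr.le hq.le))
        gcongr

theorem reducedPoissonKernel_le_mul (hr : 0 < r) (hq : q < 1) (hz : ‖z - x‖ = r)
    (hw : ‖w - x‖ ≤ q * r) (hw' : ‖w' - x‖ ≤ q * r) :
    reducedPoissonKernel x w z ≤ (1 + q) ^ 3 / (1 - q) ^ 5 * reducedPoissonKernel x w' z := by
  have : 0 < 1 - q := sub_pos.2 hq
  have hq0 : 0 ≤ q := nonneg_of_mul_nonneg_left ((norm_nonneg _).trans hw) hr
  calc reducedPoissonKernel x w z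
      ≤ 1 / ((1 - q) ^ 4 * r ^ 2) := reducedPoissonKernel_le hr hq hz hw
    _ = (1 + q) ^ 3 / (1 - q) ^ 5 * ((1 - q) / ((1 + q) ^ 3 * r ^ 2)) := by field_simp
    _ ≤ (1 + q) ^ 3 / (1 - q) ^ 5 * reducedPoissonKernel x w' z := by
        gcongr
        exact le_reducedPoissonKernel hr hq hz hw'

end ReducedPoissonKernel

section OddHarmonic

open InnerProductSpace Metric Real

variable {u : ℂ → ℝ} {x r q : ℝ} {w w' : ℂ}

theorem circleIntegrable_reducedPoissonKernel_mul (hu : ContinuousOn u (sphere (x : ℂ) r))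
    (hw : w ∈ ball (x : ℂ) r) :
    CircleIntegrable (fun z => reducedPoissonKernel x w z * (z.im * u z)) x r := by
  have hk := continuousOn_reducedPoissonKernel hw
  exact ContinuousOn.circleIntegrable (pos_of_mem_ball hw).le (by fun_prop)

theorem circleIntegrable_poissonKernel_smul {c : ℂ} (hu : ContinuousOn u (sphere c r))
    (hw : w ∈ ball c r) : CircleIntegrable (poissonKernel c w • u) c r := by
  have hr := pos_of_mem_ball hw
  refine ContinuousOn.circleIntegrable hr.le (ContinuousOn.smul ?_ hu)
  rw [poissonKernel_eq_re_herglotzRieszKernel]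
  simpa only [abs_of_pos hr] using
    Complex.continuous_re.comp_continuousOn (continuousOn_herglotzRieszKernel_sphere hw)

theorem harmonic_eq_mul_circleAverage_of_odd (hu : HarmonicOnNhd u (closedBall (x : ℂ) r))
    (hw : w ∈ ball (x : ℂ) r) (hodd : u (conj w) = -u w) :
    u w = 2 * w.im * circleAverage (fun z => reducedPoissonKernel x w z * (z.im * u z)) x r := by
  have hw' := conj_mem_ball_ofReal hw
  have hcont : ContinuousOn u (sphere (x : ℂ) r) := fun z hz =>
    (hu z (sphere_subset_closedBall hz)).1.continuousAt.continuousWithinAt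
  have hcongr : Set.EqOn (poissonKernel x w • u - poissonKernel x (conj w) • u)
      ((4 * w.im) • fun z => reducedPoissonKernel x w z * (z.im * u z))
      (sphere (x : ℂ) |r|) := fun z hz => by
    rw [abs_of_pos (pos_of_mem_ball hw)] at hz
    simp only [smul_eq_mul, Pi.sub_apply, Pi.mul_apply, Pi.smul_apply]
    rw [← sub_mul, poissonKernel_sub_poissonKernel_conj
      (sub_ne_zero_of_mem_sphere_of_mem_ball hz hw) (sub_ne_zero_of_mem_sphere_of_mem_ball hz hw')]
    ring
  have havg := circleAverage_sub (circleIntegrable_poissonKernel_smul hcont hw)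
    (circleIntegrable_poissonKernel_smul hcont hw')
  rw [hu.circleAverage_poissonKernel_smul hw, hu.circleAverage_poissonKernel_smul hw', hodd,
    circleAverage_congr_sphere hcongr, circleAverage_smul, smul_eq_mul] at havg
  linarith

/- The kernels at `w` and `w'` are comparable on the circle, and they are averaged against the same
nonnegative function `z.im * u z`. -/
theorem im_mul_harmonic_le_of_odd (hu : HarmonicOnNhd u (closedBall (x : ℂ) r))
    (hodd : ∀ z ∈ ball (x : ℂ) r, u (conj z) = -u z)
    (hsign : ∀ z ∈ sphere (x : ℂ) r, 0 ≤ z.im * u z) (hr : 0 < r) (hq : q < 1)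
    (hw : ‖w - x‖ ≤ q * r) (hw' : ‖w' - x‖ ≤ q * r) (him : 0 ≤ w.im) (him' : 0 ≤ w'.im) :
    w'.im * u w ≤ (1 + q) ^ 3 / (1 - q) ^ 5 * (w.im * u w') := by
  have hball {v : ℂ} (hv : ‖v - x‖ ≤ q * r) : v ∈ ball (x : ℂ) r :=
    mem_ball_iff_norm.2 (hv.trans_lt (mul_lt_of_lt_one_left hr hq))
  have hcont : ContinuousOn u (sphere (x : ℂ) r) := fun z hz =>
    (hu z (sphere_subset_closedBall hz)).1.continuousAt.continuousWithinAt
  have hmono := circleAverage_mono (circleIntegrable_reducedPoissonKernel_mul hcont (hball hw))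
    ((circleIntegrable_reducedPoissonKernel_mul hcont (hball hw')).const_smul
      (a := (1 + q) ^ 3 / (1 - q) ^ 5)) fun z hz => by
    rw [abs_of_pos hr] at hz
    rw [Pi.smul_apply, smul_eq_mul, ← mul_assoc (_ / _)]
    exact mul_le_mul_of_nonneg_right
      (reducedPoissonKernel_le_mul hr hq (mem_sphere_iff_norm.1 hz) hw hw') (hsign z hz)
  rw [circleAverage_smul, smul_eq_mul] at hmono
  rw [harmonic_eq_mul_circleAverage_of_odd hu (hball hw) (hodd w (hball hw)),
    harmonic_eq_mul_circleAverage_of_odd hu (hball hw') (hodd w' (hball hw'))]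
  linarith [mul_le_mul_of_nonneg_left hmono (by positivity : 0 ≤ 2 * w.im * w'.im)]

end OddHarmonic

section ZeroFree

variable {f : ℂ → ℂ}

namespace IsRegularInner

theorem neg_log_norm_nonneg (hf : IsRegularInner f) {z : ℂ} (hz : 0 ≤ z.im) :
    0 ≤ -Real.log ‖f z‖ :=
  neg_nonneg.2 (Real.log_nonpos (norm_nonneg _) (hf.norm_le_one z hz))

theorem neg_log_norm_schwarzReflection_conj (hf : IsRegularInner f) (z : ℂ) :
    -Real.log ‖schwarzReflection f (conj z)‖ = -(-Real.log ‖schwarzReflection f z‖) := by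
  rw [hf.norm_schwarzReflection_conj, Real.log_inv]

theorem im_mul_neg_log_norm_schwarzReflection_nonneg (hf : IsRegularInner f) (z : ℂ) :
    0 ≤ z.im * -Real.log ‖schwarzReflection f z‖ := by
  have hupper {w : ℂ} (hw : 0 ≤ w.im) : 0 ≤ w.im * -Real.log ‖schwarzReflection f w‖ := by
    rw [schwarzReflection_of_im_nonneg hw]
    exact mul_nonneg hw (hf.neg_log_norm_nonneg hw)
  rcases le_total 0 z.im with hz | hz
  · exact hupper hz
  · have h := hupper (w := conj z) (by simpa using hz)
    rwa [hf.neg_log_norm_schwarzReflection_conj, Complex.conj_im, neg_mul_neg] at h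

theorem norm_deriv_le_of_zeroFree (hf : IsRegularInner f) {x y r q : ℝ} (hr : 0 < r) (hq : q < 1)
    (hy : |y - x| < q * r) (hfree : ∀ z ∈ Metric.closedBall (x : ℂ) r, 0 < z.im → f z ≠ 0) :
    ‖deriv f x‖ ≤ (1 + q) ^ 3 / (1 - q) ^ 5 * ‖deriv f y‖ := by
  have hnear {s : ℝ} (hs : |s - x| < q * r) :
      ∀ᶠ t : ℝ in 𝓝[>] 0, ‖(s + t * Complex.I : ℂ) - x‖ ≤ q * r := by
    refine nhdsWithin_le_nhds (Tendsto.eventually_le_const (v := |s - x|) hs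
      (Continuous.tendsto' (by fun_prop) _ _ ?_))
    rw [Complex.ofReal_zero, zero_mul, add_zero, ← Complex.ofReal_sub, Complex.norm_real,
      Real.norm_eq_abs]
  have hx : |x - x| < q * r := by simpa using (abs_nonneg _).trans_lt hy
  refine le_of_hasDerivAt_of_eventually_le_right (by simpa using (hf.hasDerivAt_log_norm x).neg)
    ((hf.hasDerivAt_log_norm y).neg.const_mul _ |>.congr_deriv (by rw [neg_neg]))
    (by simp [hf.norm_ofReal]) ?_
  filter_upwards [self_mem_nhdsWithin, hnear hx, hnear hy] with t (ht : 0 < t) htx hty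
  have him (s : ℝ) : (s + t * Complex.I : ℂ).im = t := by simp
  have hharnack := im_mul_harmonic_le_of_odd
    (hf.harmonicOnNhd_neg_log_norm_schwarzReflection hfree)
    (fun z _ => hf.neg_log_norm_schwarzReflection_conj z)
    (fun z _ => hf.im_mul_neg_log_norm_schwarzReflection_nonneg z) hr hq htx hty
    ((him x).symm ▸ ht.le) ((him y).symm ▸ ht.le)
  rw [schwarzReflection_of_im_nonneg (by rw [him]; exact ht.le),
    schwarzReflection_of_im_nonneg (by rw [him]; exact ht.le), him, him, mul_left_comm] at hharnack
  exact le_of_mul_le_mul_left hharnack ht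

end IsRegularInner

theorem exists_radius_norm_deriv_le {C : ℝ} (hC : 1 < C) (x y : ℝ) :
    ∃ r : ℝ, ∀ f : ℂ → ℂ, IsRegularInner f →
      (∀ z ∈ Metric.closedBall (x : ℂ) r, 0 < z.im → f z ≠ 0) →
        ‖deriv f x‖ ≤ C * ‖deriv f y‖ := by
  have htendsto : Tendsto (fun q : ℝ => (1 + q) ^ 3 / (1 - q) ^ 5) (𝓝[>] 0) (𝓝 1) := by
    have hcont : ContinuousAt (fun q : ℝ => (1 + q) ^ 3 / (1 - q) ^ 5) 0 :=
      ContinuousAt.div (by fun_prop) (by fun_prop) (by norm_num)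
    simpa using hcont.tendsto.mono_left nhdsWithin_le_nhds
  obtain ⟨q, ⟨hqC, hq1⟩, (hq0 : 0 < q)⟩ := ((htendsto.eventually_le_const hC).and
    (nhdsWithin_le_nhds (gt_mem_nhds one_pos)) |>.and self_mem_nhdsWithin).exists
  refine ⟨(|y - x| + 1) / q, fun f hf hfree => ?_⟩
  have hy : |y - x| < q * ((|y - x| + 1) / q) := by
    rw [mul_div_cancel₀ _ hq0.ne']
    exact lt_add_one _
  calc ‖deriv f x‖ ≤ (1 + q) ^ 3 / (1 - q) ^ 5 * ‖deriv f y‖ :=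
        hf.norm_deriv_le_of_zeroFree (by positivity) hq1 hy hfree
    _ ≤ C * ‖deriv f y‖ := by gcongr

end ZeroFree

section MainInequality

variable {f : ℂ → ℂ}

theorem IsRegularInner.norm_deriv_le_of_zeros_far (hf : IsRegularInner f) {x ρ : ℝ} (hρ : 0 < ρ)
    (hfar : ∀ z : ℂ, 0 < z.im → f z = 0 → ρ ≤ ‖z - x‖) (y : ℝ) :
    ‖deriv f x‖ ≤ (1 + |y - x| / ρ) ^ 2 * ‖deriv f y‖ := by
  rcases eq_or_ne x y with rfl | hxy
  · simp
  have hC : 1 < (1 + |y - x| / ρ) ^ 2 := by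
    have : 0 < |y - x| := abs_pos.2 (sub_ne_zero.2 hxy.symm)
    exact one_lt_pow₀ (lt_add_of_pos_right 1 (by positivity)) two_ne_zero
  obtain ⟨r, hr⟩ := exists_radius_norm_deriv_le hC x y
  obtain ⟨L, g, hL, hg, hfree, hsum⟩ := hf.exists_norm_deriv_eq_sum_add x r
  rw [hsum x, hsum y, mul_add, ← Multiset.sum_map_mul_left]
  refine add_le_add (Multiset.sum_map_le_sum_map _ _ fun l hl => ?_) (hr g hg hfree)
  exact norm_deriv_blaschkeFactor_le (hL l hl).1 hρ (hfar l (hL l hl).1 (hL l hl).2) y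

theorem div_sqrt_one_add_sub_one_le {d ε : ℝ} (hd : 0 ≤ d) (hε : 0 < ε) (hε8 : ε ≤ 8) :
    d / (√(1 + ε) - 1) ≤ 4 * d / ε := by
  have hlower : 1 + ε / 4 ≤ √(1 + ε) := by
    apply Real.le_sqrt_of_sq_le
    nlinarith
  calc d / (√(1 + ε) - 1) ≤ d / (ε / 4) := by
        gcongr
        linarith
    _ = 4 * d / ε := by ring

theorem mainTheorem10_general (hf : IsRegularInner f) {ε : ℝ} (hε : 0 < ε) {x y : ℝ}
    (hxy : (1 + ε) * ‖deriv f y‖ < ‖deriv f x‖) :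
    ∃ z : ℂ, 0 < z.im ∧ ‖z - x‖ < |y - x| / (√(1 + ε) - 1) ∧ f z = 0 := by
  have hs : 0 < √(1 + ε) - 1 := sub_pos.2 (Real.lt_sqrt_of_sq_lt (by linarith))
  have hd : 0 < |y - x| := by
    refine abs_pos.2 (sub_ne_zero.2 fun h => ?_)
    rw [h] at hxy
    nlinarith [norm_nonneg (deriv f x)]
  by_contra! hfree
  have hle := hf.norm_deriv_le_of_zeros_far (ρ := |y - x| / (√(1 + ε) - 1)) (div_pos hd hs)
    (fun z hz hfz => not_lt.1 fun hzx => hfree z hz hzx hfz) y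
  rw [div_div_cancel₀ hd.ne', add_sub_cancel, Real.sq_sqrt (by linarith)] at hle
  exact hxy.not_ge hle

end MainInequality

theorem mainTheorem10 :
    ∃ ε₀ : ℝ, 0 < ε₀ ∧
      ∀ ε : ℝ, 0 < ε → ε < ε₀ →
        ∀ θ : ℂ → ℂ, IsMeromorphicInner θ →
          ∀ x y : ℝ, 1 + ε < ‖deriv θ (x : ℂ)‖ / ‖deriv θ (y : ℂ)‖ →
            ∃ z : ℂ, ‖z - (x : ℂ)‖ < 4 * |y - x| / ε ∧ IsZeroOf θ z := by
  refine ⟨8, by norm_num, fun ε hε hε8 θ hθ x y hratio => ?_⟩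
  have hxy : (1 + ε) * ‖deriv θ y‖ < ‖deriv θ x‖ := lt_of_not_ge fun h =>
    hratio.not_ge (div_le_of_le_mul₀ (norm_nonneg _) (by positivity) h)
  obtain ⟨z, hz, hzx, hθz⟩ := mainTheorem10_general hθ.isRegularInner hε hxy
  exact ⟨z, hzx.trans_le (div_sqrt_one_add_sub_one_le (abs_nonneg _) hε hε8.le),
    hθ.inner.analytic z hz, hθz⟩
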